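/- Let $G=(V,E)$ be a finite simple undirected graph of order $n=|V|$ and maximum degree $\Delta>0$, containing no clique of size $4$. Let $a(G)$ denote the maximum size of a set $S\subseteq V$ such that the induced subgraph $G[S]$ is a forest. Then $$a(G)\ \ge\ \frac{6n}{2\Delta+5}.$$ -/

import Mathlib

/-- A set of vertices `S` is an acyclic set of `G` if the induced subgraph `G[S]` is a forest. -/
def IsAcyclicSet {V : Type*} (G : SimpleGraph V) (S : Finset V) : Prop :=
  (G.induce (S : Set V)).IsAcyclic

open Classical in
/-- `a(G)`, the maximum size of an acyclic set of a finite graph `G`. The empty set is acyclic, so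
the maximum is over a nonempty finite family. -/
noncomputable def acyclicNumber {V : Type*} [Fintype V] (G : SimpleGraph V) : ℕ :=
  (Finset.univ.filter fun S : Finset V => IsAcyclicSet G S).sup Finset.card

open Finset

/-! Let `S` be a largest set inducing a forest, `J` its vertices with a neighbour in `S`, `I` the
others. By maximality each `w ∉ S` has two neighbours in one component of `G[S]`, hence at least two
in `J`. The target is `3 |Sᶜ| ≤ |S| (Δ - 1/2)`, which rearranges to the bound.

With `ε = 1/(2Δ)`, an edge from `w` to `J` counts 1 and an edge to `I` counts `1 - ε`; this reaches
3 unless `w` is 0-tight (short by 1) or 1-tight (short by `ε`). The deficits are paid by the linked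
vertices, whose edges inside `S` are lost to `Sᶜ`. A tree on `t` vertices can pay for a load of `2 ·
2(t - 1) - t = 3t - 4`, each tight vertex being counted at both of its linked neighbours. Exchange
arguments make tight vertices at a common linked neighbour adjacent when one of them is 0-tight
(`adj_of_isTight`), so the absence of `K₄` bounds each load by 2. This suffices for `t ≥ 4`;
`load_le_one` and `sum_load_le_five` treat `t = 2, 3`. -/

/-- The spanning subgraph of `G` whose edges are those with both ends in `S`. -/
def edgesWithin {V : Type*} (G : SimpleGraph V) (S : Finset V) : SimpleGraph V where
  Adj u v := u ∈ S ∧ v ∈ S ∧ G.Adj u v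
  symm := ⟨fun _ _ h => ⟨h.2.1, h.1, h.2.2.symm⟩⟩
  loopless := ⟨fun _ h => G.loopless.irrefl _ h.2.2⟩

/-! ### Enlarging forests one vertex at a time. -/

section Acyclic

variable {V : Type*} {G : SimpleGraph V} {S : Finset V}

theorem edgesWithin_adj {u v : V} :
    (edgesWithin G S).Adj u v ↔ u ∈ S ∧ v ∈ S ∧ G.Adj u v := Iff.rfl

theorem edgesWithin_mono {T : Finset V} (h : S ⊆ T) : edgesWithin G S ≤ edgesWithin G T :=
  fun _ _ ha => ⟨h ha.1, h ha.2.1, ha.2.2⟩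

theorem IsAcyclicSet.of_edgesWithin (h : (edgesWithin G S).IsAcyclic) : IsAcyclicSet G S :=
  let f : G.induce (S : Set V) →g edgesWithin G S :=
    { toFun := Subtype.val, map_rel' := fun {a b} hab => ⟨a.2, b.2, hab⟩ }
  h.comap f Subtype.val_injective

/-- A cycle avoiding `w` already lies in `S`. A cycle through `w`, rotated to start there, enters
and leaves by two distinct neighbours joined by a path inside `S`. -/
theorem edgesWithin_isAcyclic_insert {w : V} [DecidableEq V] (h : (edgesWithin G S).IsAcyclic)
    (hw : ∀ x ∈ S, ∀ y ∈ S, x ≠ y → G.Adj w x → G.Adj w y → ¬ (edgesWithin G S).Reachable x y) :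
    (edgesWithin G (insert w S)).IsAcyclic := by
  have key : ∀ {a b : V} (p : (edgesWithin G (insert w S)).Walk a b), w ∉ p.support →
      ∀ e ∈ p.edges, e ∈ (edgesWithin G S).edgeSet := by
    intro a b p hp e he
    induction e with
    | h x y =>
      have h1 := p.adj_of_mem_edges he
      have hx : x ≠ w := fun h => hp (h ▸ p.fst_mem_support_of_mem_edges he)
      have hy : y ≠ w := fun h => hp (h ▸ p.snd_mem_support_of_mem_edges he)
      exact ⟨mem_of_mem_insert_of_ne h1.1 hx, mem_of_mem_insert_of_ne h1.2.1 hy, h1.2.2⟩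
  intro v c hc
  by_cases hwc : w ∈ c.support
  · have hr := hc.rotate hwc
    generalize c.rotate w hwc = c' at hr
    cases c' with
    | nil => exact hr.ne_nil rfl
    | cons hadj p =>
      rename_i s
      rw [SimpleGraph.Walk.cons_isCycle_iff] at hr
      obtain ⟨hp, hnot⟩ := hr
      have hp' := hp.reverse
      have hnot' : s(w, s) ∉ p.reverse.edges := by simpa using hnot
      generalize p.reverse = q at hp' hnot'
      cases q with
      | nil => exact hadj.ne rfl
      | cons hadj2 q =>
        rename_i s2
        rw [SimpleGraph.Walk.cons_isPath_iff] at hp'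
        have hne : s2 ≠ s := by
          rintro rfl
          exact hnot' (by simp)
        refine hw s2 (mem_of_mem_insert_of_ne hadj2.2.1 hadj2.ne') s
          (mem_of_mem_insert_of_ne hadj.2.1 hadj.ne') hne hadj2.2.2 hadj.2.2 ?_
        exact ⟨q.transfer _ (key q hp'.2)⟩
  · exact h _ (hc.transfer (key c hwc))

theorem edgesWithin_isAcyclic_mono {T : Finset V} (hST : S ⊆ T)
    (h : (edgesWithin G T).IsAcyclic) : (edgesWithin G S).IsAcyclic :=
  h.anti (edgesWithin_mono hST)

theorem edgesWithin_isAcyclic_insert_leaf {w : V} [DecidableEq V]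
    (h : (edgesWithin G S).IsAcyclic)
    (hw : ∀ x ∈ S, ∀ y ∈ S, G.Adj w x → G.Adj w y → x = y) :
    (edgesWithin G (insert w S)).IsAcyclic :=
  edgesWithin_isAcyclic_insert h fun x hx y hy hne h1 h2 => (hne (hw x hx y hy h1 h2)).elim

theorem eq_of_edgesWithin_reachable {v y : V} (hv : ∀ z ∈ S, ¬ G.Adj v z)
    (h : (edgesWithin G S).Reachable v y) : v = y := by
  obtain ⟨p⟩ := h
  cases p with
  | nil => rfl
  | cons h p => exact (hv _ h.2.1 h.2.2).elim

theorem exists_adj_of_edgesWithin_reachable {v y : V} (hne : v ≠ y)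
    (h : (edgesWithin G S).Reachable v y) : ∃ z ∈ S, G.Adj v z := by
  by_contra hcon
  push Not at hcon
  exact hne (eq_of_edgesWithin_reachable hcon h)

/-- A connected component with `t` vertices has degree sum at least `2 (t - 1)`. -/
theorem two_mul_card_le_sum_degree [Fintype V] [DecidableEq V] (F : SimpleGraph V)
    [DecidableRel F.Adj] (C : F.ConnectedComponent) (T : Finset V)
    (hT : ∀ x, x ∈ T ↔ F.connectedComponentMk x = C) :
    2 * #T ≤ ∑ x ∈ T, F.degree x + 2 := by
  classical
  have hT' : ∀ x, x ∈ T ↔ x ∈ C := hT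
  have h1 := C.connected_toSimpleGraph.card_vert_le_card_edgeSet_add_one
  have h2 := C.toSimpleGraph.sum_degrees_eq_twice_card_edges
  have h3 : Nat.card {x // x ∈ C} = #T := Nat.subtype_card (p := (· ∈ C)) T hT'
  have h4 : ∑ v : C, C.toSimpleGraph.degree v ≤ ∑ x ∈ T, F.degree x := by
    have hs : ∑ x ∈ T, F.degree x = ∑ v : C, F.degree v :=
      Finset.sum_subtype (p := (· ∈ C)) T hT' fun x => F.degree x
    rw [hs]
    refine Finset.sum_le_sum fun v _ => ?_
    rw [← SimpleGraph.card_neighborFinset_eq_degree, ← SimpleGraph.card_neighborFinset_eq_degree]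
    refine Finset.card_le_card_of_injOn Subtype.val (fun y hy => ?_) Subtype.val_injective.injOn
    rw [Finset.mem_coe, SimpleGraph.mem_neighborFinset] at hy ⊢
    exact C.toSimpleGraph_hom.map_adj hy
  have h5 : Nat.card C.toSimpleGraph.edgeSet = #C.toSimpleGraph.edgeFinset := by
    rw [Nat.card_eq_fintype_card, SimpleGraph.edgeFinset_card]
  omega

end Acyclic

/-! ### Tight vertices and the load at a single vertex. -/

section Tight

set_option linter.unusedSectionVars false

variable {V : Type*} [Fintype V] [DecidableEq V] (G : SimpleGraph V) [DecidableRel G.Adj]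
  (S : Finset V)

/-- The vertices of `S` that have a neighbour in `S`. -/
def linkedPart : Finset V := S.filter fun x => ∃ y ∈ S, G.Adj x y

/-- The isolated vertices of `G[S]`. -/
def isolatedPart : Finset V := S.filter fun x => ¬ ∃ y ∈ S, G.Adj x y

/-- A vertex outside `S` is `k`-tight if it has two neighbours in the linked part of `S` and `k`
neighbours in the isolated part. -/
def IsTight (k : ℕ) (w : V) : Prop :=
  w ∉ S ∧ #((linkedPart G S).filter (G.Adj w)) = 2 ∧ #((isolatedPart G S).filter (G.Adj w)) = k

instance (k : ℕ) : DecidablePred (IsTight G S k) := fun _ => by unfold IsTight; infer_instance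

/-- The `k`-tight neighbours of `x`. -/
def tightAt (k : ℕ) (x : V) : Finset V := univ.filter fun w => G.Adj x w ∧ IsTight G S k w

/-- `S` is a largest set inducing a forest. -/
def IsMaxForestSet : Prop :=
  (edgesWithin G S).IsAcyclic ∧ ∀ T : Finset V, (edgesWithin G T).IsAcyclic → #T ≤ #S

variable {G S}

theorem mem_tightAt {k : ℕ} {x w : V} : w ∈ tightAt G S k x ↔ G.Adj x w ∧ IsTight G S k w := by
  simp [tightAt]

theorem mem_linkedPart {x : V} : x ∈ linkedPart G S ↔ x ∈ S ∧ ∃ y ∈ S, G.Adj x y := by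
  simp [linkedPart]

theorem mem_isolatedPart {x : V} : x ∈ isolatedPart G S ↔ x ∈ S ∧ ∀ y ∈ S, ¬ G.Adj x y := by
  simp [isolatedPart]

theorem mem_linkedPart_or_isolatedPart {x : V} (hx : x ∈ S) :
    x ∈ linkedPart G S ∨ x ∈ isolatedPart G S := by
  by_cases h : ∃ y ∈ S, G.Adj x y
  · exact .inl (mem_linkedPart.2 ⟨hx, h⟩)
  · exact .inr (mem_filter.2 ⟨hx, h⟩)

theorem mem_linkedPart_of_reachable {x y : V} (hx : x ∈ linkedPart G S)
    (h : (edgesWithin G S).Reachable x y) : y ∈ linkedPart G S := by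
  by_cases hxy : x = y
  · exact hxy ▸ hx
  · obtain ⟨p⟩ := h.symm
    cases p with
    | nil => exact hx
    | cons h p => exact mem_linkedPart.2 ⟨h.1, _, h.2.1, h.2.2⟩

theorem mem_linkedPart_of_reachable_of_ne {x y : V} (hx : x ∈ S) (hne : x ≠ y)
    (h : (edgesWithin G S).Reachable x y) : x ∈ linkedPart G S :=
  mem_linkedPart.2 ⟨hx, exists_adj_of_edgesWithin_reachable hne h⟩

theorem IsMaxForestSet.exists_reachable_pair (hS : IsMaxForestSet G S) {w : V} (hw : w ∉ S) :
    ∃ x ∈ linkedPart G S, ∃ y ∈ linkedPart G S, x ≠ y ∧ G.Adj w x ∧ G.Adj w y ∧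
      (edgesWithin G S).Reachable x y := by
  by_contra hcon
  have h := hS.2 (insert w S) (edgesWithin_isAcyclic_insert hS.1 fun x hx y hy hne h1 h2 hr =>
    hcon ⟨x, mem_linkedPart_of_reachable_of_ne hx hne hr, y,
      mem_linkedPart_of_reachable_of_ne hy hne.symm hr.symm, hne, h1, h2, hr⟩)
  rw [card_insert_of_notMem hw] at h
  omega

theorem IsMaxForestSet.two_le_card_linked (hS : IsMaxForestSet G S) {w : V} (hw : w ∉ S) :
    2 ≤ #((linkedPart G S).filter (G.Adj w)) := by
  obtain ⟨x, hx, y, hy, hne, h1, h2, -⟩ := hS.exists_reachable_pair hw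
  rw [← card_pair hne]
  apply card_le_card
  intro z hz
  rcases mem_insert.1 hz with rfl | hz
  · simp [hx, h1]
  · rw [mem_singleton.1 hz]; simp [hy, h2]

theorem IsTight.eq_or_eq {k : ℕ} {w x y z : V} (hw : IsTight G S k w) (hne : x ≠ y)
    (hx : x ∈ linkedPart G S) (hy : y ∈ linkedPart G S) (hz : z ∈ linkedPart G S)
    (h1 : G.Adj w x) (h2 : G.Adj w y) (h3 : G.Adj w z) : z = x ∨ z = y := by
  by_contra! hcon
  have h : 2 < #((linkedPart G S).filter (G.Adj w)) :=
    two_lt_card.2 ⟨x, by simp [hx, h1], y, by simp [hy, h2], z, by simp [hz, h3], hne,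
      hcon.1.symm, hcon.2.symm⟩
  have := hw.2.1
  omega

theorem IsTight.mem_linkedPart {w z : V} (hw : IsTight G S 0 w) (hz : z ∈ S) (h : G.Adj w z) :
    z ∈ linkedPart G S := by
  refine (mem_linkedPart_or_isolatedPart hz).resolve_right fun hi => ?_
  have := card_eq_zero.1 hw.2.2
  exact (Finset.notMem_empty z) (this ▸ mem_filter.2 ⟨hi, h⟩)

/-- The only two linked neighbours of a tight vertex must be the pair in a common component supplied
by maximality. -/
theorem IsMaxForestSet.exists_partner (hS : IsMaxForestSet G S) {k : ℕ} {w x : V}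
    (hw : IsTight G S k w) (hx : x ∈ linkedPart G S) (h : G.Adj w x) :
    ∃ y ∈ linkedPart G S, y ≠ x ∧ G.Adj w y ∧ (edgesWithin G S).Reachable x y := by
  obtain ⟨a, ha, b, hb, hne, h1, h2, hr⟩ := hS.exists_reachable_pair hw.1
  rcases hw.eq_or_eq hne ha hb hx h1 h2 h with rfl | rfl
  · exact ⟨b, hb, hne.symm, h2, hr⟩
  · exact ⟨a, ha, hne, h1, hr.symm⟩

/-- Two tight vertices with a common neighbour `x` are adjacent: otherwise `x` could be exchanged
for both of them. -/
theorem IsMaxForestSet.adj_of_isTight (hS : IsMaxForestSet G S) {k : ℕ} {u w x : V}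
    (hu : IsTight G S 0 u) (hw : IsTight G S k w) (hne : u ≠ w) (hx : x ∈ linkedPart G S)
    (hux : G.Adj u x) (hwx : G.Adj w x) : G.Adj u w := by
  by_contra hadj
  have hxS : x ∈ S := (_root_.mem_linkedPart.1 hx).1
  have hsub : S.erase x ⊆ S := erase_subset _ _
  have h0 : (edgesWithin G (S.erase x)).IsAcyclic := edgesWithin_isAcyclic_mono hsub hS.1
  have hiso : ∀ p q, p ∈ isolatedPart G S → p ≠ q →
      ¬ (edgesWithin G (S.erase x)).Reachable p q := fun p q hp hpq hr =>
    hpq (eq_of_edgesWithin_reachable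
      (fun z hz => (mem_isolatedPart.1 hp).2 z (hsub hz)) hr)
  -- Without `x`, one linked neighbour of `w` remains; its other neighbours are isolated, so no two
  -- of them are connected.
  have h1 : (edgesWithin G (insert w (S.erase x))).IsAcyclic := by
    refine edgesWithin_isAcyclic_insert h0 fun p hp q hq hpq hap haq => ?_
    rcases mem_linkedPart_or_isolatedPart (hsub hp) (G := G) with hp' | hp'
    · rcases mem_linkedPart_or_isolatedPart (hsub hq) (G := G) with hq' | hq'
      · rcases hw.eq_or_eq hpq hp' hq' hx hap haq hwx with rfl | rfl
        · exact absurd hp (notMem_erase _ _)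
        · exact absurd hq (notMem_erase _ _)
      · exact fun hr => hiso q p hq' hpq.symm hr.symm
    · exact hiso p q hp' hpq
  -- Being 0-tight and not adjacent to `w`, the vertex `u` keeps at most one neighbour: it is a leaf
  -- or isolated.
  have h2 : (edgesWithin G (insert u (insert w (S.erase x)))).IsAcyclic := by
    refine edgesWithin_isAcyclic_insert_leaf h1 fun p hp q hq hap haq => ?_
    have hp' : p ∈ S.erase x := mem_of_mem_insert_of_ne hp fun h => hadj (h ▸ hap)
    have hq' : q ∈ S.erase x := mem_of_mem_insert_of_ne hq fun h => hadj (h ▸ haq)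
    by_contra hpq
    rcases hu.eq_or_eq hpq (hu.mem_linkedPart (hsub hp') hap) (hu.mem_linkedPart (hsub hq') haq)
      hx hap haq hux with rfl | rfl
    · exact absurd hp' (notMem_erase _ _)
    · exact absurd hq' (notMem_erase _ _)
  have h3 := hS.2 _ h2
  have hwn : w ∉ S.erase x := fun h => hw.1 (hsub h)
  have hun : u ∉ insert w (S.erase x) := by
    rw [mem_insert, not_or]
    exact ⟨hne, fun h => hu.1 (hsub h)⟩
  rw [card_insert_of_notMem hun, card_insert_of_notMem hwn, card_erase_add_one hxS] at h3
  omega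

theorem SimpleGraph.CliqueFree.not_pairwise_adj (h : G.CliqueFree 4) {a b c d : V}
    (hab : G.Adj a b) (hac : G.Adj a c) (had : G.Adj a d) (hbc : G.Adj b c) (hbd : G.Adj b d)
    (hcd : G.Adj c d) : False :=
  h {a, b, c, d} <| by
    have h3 : G.IsNClique 3 {b, c, d} := SimpleGraph.is3Clique_triple_iff.2 ⟨hbc, hbd, hcd⟩
    refine h3.insert fun x hx => ?_
    simp only [mem_insert, mem_singleton] at hx
    rcases hx with rfl | rfl | rfl <;> assumption

/-- Three 0-tight neighbours of `x` are pairwise adjacent and form a `K₄` with `x`. -/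
theorem IsMaxForestSet.card_tightAt_zero_le (hS : IsMaxForestSet G S) (hK : G.CliqueFree 4)
    {x : V} (hx : x ∈ linkedPart G S) : #(tightAt G S 0 x) ≤ 2 := by
  by_contra! hcon
  obtain ⟨a, ha, b, hb, c, hc, hab, hac, hbc⟩ := two_lt_card.1 hcon
  rw [mem_tightAt] at ha hb hc
  exact hK.not_pairwise_adj ha.1 hb.1 hc.1
    (hS.adj_of_isTight ha.2 hb.2 hab hx ha.1.symm hb.1.symm)
    (hS.adj_of_isTight ha.2 hc.2 hac hx ha.1.symm hc.1.symm)
    (hS.adj_of_isTight hb.2 hc.2 hbc hx hb.1.symm hc.1.symm)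

theorem IsTight.ne {k l : ℕ} (hkl : k ≠ l) {u w : V} (hu : IsTight G S k u)
    (hw : IsTight G S l w) : u ≠ w := by
  rintro rfl
  exact hkl (hu.2.2.symm.trans hw.2.2)

theorem IsMaxForestSet.card_tightAt_zero_le_one (hS : IsMaxForestSet G S) (hK : G.CliqueFree 4)
    {x : V} (hx : x ∈ linkedPart G S) (hne : (tightAt G S 1 x).Nonempty) :
    #(tightAt G S 0 x) ≤ 1 := by
  obtain ⟨c, hc⟩ := hne
  by_contra! hcon
  obtain ⟨a, ha, b, hb, hab⟩ := one_lt_card.1 hcon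
  rw [mem_tightAt] at ha hb hc
  exact hK.not_pairwise_adj ha.1 hb.1 hc.1
    (hS.adj_of_isTight ha.2 hb.2 hab hx ha.1.symm hb.1.symm)
    (hS.adj_of_isTight ha.2 hc.2 (ha.2.ne zero_ne_one hc.2) hx ha.1.symm hc.1.symm)
    (hS.adj_of_isTight hb.2 hc.2 (hb.2.ne zero_ne_one hc.2) hx hb.1.symm hc.1.symm)

theorem card_tightAt_le_maxDegree (k : ℕ) (x : V) : #(tightAt G S k x) ≤ G.maxDegree := by
  refine le_trans (card_le_card fun w hw => ?_) (G.degree_le_maxDegree x)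
  exact (G.mem_neighborFinset x w).2 (mem_tightAt.1 hw).1

variable (G S) in
/-- The total weight of the tight neighbours of `x`: those that are `0`-tight weigh `1`, and those
that are `1`-tight weigh `ε`. -/
noncomputable def load (ε : ℝ) (x : V) : ℝ := #(tightAt G S 0 x) + ε * #(tightAt G S 1 x)

variable {ε : ℝ}

theorem mul_card_tightAt_le (hε : 0 ≤ ε) (hΔ : ε * G.maxDegree ≤ 1 / 2) (k : ℕ) (x : V) :
    ε * #(tightAt G S k x) ≤ 1 / 2 :=
  (mul_le_mul_of_nonneg_left (by exact_mod_cast card_tightAt_le_maxDegree k x) hε).trans hΔ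

theorem IsMaxForestSet.load_le_of_nonempty (hS : IsMaxForestSet G S) (hK : G.CliqueFree 4)
    (hε : 0 ≤ ε) (hΔ : ε * G.maxDegree ≤ 1 / 2) {x : V} (hx : x ∈ linkedPart G S)
    (hne : (tightAt G S 1 x).Nonempty) : load G S ε x ≤ 3 / 2 := by
  have h1 : (#(tightAt G S 0 x) : ℝ) ≤ 1 := by exact_mod_cast hS.card_tightAt_zero_le_one hK hx hne
  have h2 := mul_card_tightAt_le (S := S) hε hΔ 1 x
  unfold load
  linarith

theorem IsMaxForestSet.load_le_two (hS : IsMaxForestSet G S) (hK : G.CliqueFree 4)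
    (hε : 0 ≤ ε) (hΔ : ε * G.maxDegree ≤ 1 / 2) {x : V} (hx : x ∈ linkedPart G S) :
    load G S ε x ≤ 2 := by
  by_cases hne : (tightAt G S 1 x).Nonempty
  · linarith [hS.load_le_of_nonempty hK hε hΔ hx hne]
  · rw [not_nonempty_iff_eq_empty] at hne
    have h1 : (#(tightAt G S 0 x) : ℝ) ≤ 2 := by exact_mod_cast hS.card_tightAt_zero_le hK hx
    simpa [load, hne] using h1

/-- A component that is a single edge carries at most one tight vertex, counted with weight. -/
theorem IsMaxForestSet.load_le_one (hS : IsMaxForestSet G S) (hK : G.CliqueFree 4)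
    (hε : 0 ≤ ε) (hΔ : ε * G.maxDegree ≤ 1 / 2) {x y : V} (hx : x ∈ linkedPart G S)
    (hy : ∀ z, (edgesWithin G S).Reachable x z → z = x ∨ z = y) : load G S ε x ≤ 1 := by
  have hadj : G.Adj x y := by
    obtain ⟨hxS, z, hz, hxz⟩ := mem_linkedPart.1 hx
    have hr : (edgesWithin G S).Adj x z := ⟨hxS, hz, hxz⟩
    rcases hy z hr.reachable with rfl | rfl
    · exact (hxz.ne rfl).elim
    · exact hxz
  -- The partner of `x` can only be `y`, so two adjacent tight neighbours of `x` would complete a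
  -- `K₄` on the edge `xy`.
  have hpart : ∀ {k w}, G.Adj x w → IsTight G S k w → G.Adj y w := by
    intro k w h hw
    obtain ⟨z, -, hzx, hwz, hr⟩ := hS.exists_partner hw hx h.symm
    rcases hy z hr with rfl | rfl
    · exact (hzx rfl).elim
    · exact hwz.symm
  have hno : ∀ {k u w}, G.Adj x u → IsTight G S 0 u → G.Adj x w → IsTight G S k w →
      u = w := by
    intro k u w hxu hu hxw hw
    by_contra hne
    exact hK.not_pairwise_adj hadj hxu hxw (hpart hxu hu) (hpart hxw hw)
      (hS.adj_of_isTight hu hw hne hx hxu.symm hxw.symm)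
  by_cases hne : (tightAt G S 0 x).Nonempty
  · obtain ⟨u, hu⟩ := hne
    rw [mem_tightAt] at hu
    have h1 : tightAt G S 1 x = ∅ := by
      refine eq_empty_of_forall_notMem fun w hw => ?_
      rw [mem_tightAt] at hw
      exact hu.2.ne zero_ne_one hw.2 (hno hu.1 hu.2 hw.1 hw.2)
    have h2 : #(tightAt G S 0 x) ≤ 1 := by
      refine card_le_one.2 fun a ha b hb => ?_
      rw [mem_tightAt] at ha hb
      exact hno ha.1 ha.2 hb.1 hb.2
    simpa [load, h1] using h2
  · rw [not_nonempty_iff_eq_empty] at hne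
    have h2 := mul_card_tightAt_le (S := S) hε hΔ 1 x
    simp only [load, hne, card_empty, Nat.cast_zero]
    linarith

end Tight

/-! ### The total load of a component of the forest. -/

section Component

set_option linter.unusedSectionVars false

variable {V : Type*} [Fintype V] [DecidableEq V] {G : SimpleGraph V} [DecidableRel G.Adj]
  {S : Finset V} {ε : ℝ}

/-- A component on three vertices `a`, `b`, `c` cannot have tight vertices on both `{a, b}` and
`{b, c}`, where `a` and `c` are not adjacent: `b` could be exchanged for both of them. -/
theorem IsMaxForestSet.false_of_isTight_pair (hS : IsMaxForestSet G S) {a b c u w : V}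
    (ha : a ∈ linkedPart G S) (hb : b ∈ linkedPart G S) (hc : c ∈ linkedPart G S)
    (hab : a ≠ b) (hac : a ≠ c) (hbc : b ≠ c)
    (hT : ∀ x y, (x = a ∨ x = b ∨ x = c) → y ∈ S → G.Adj x y → y = a ∨ y = b ∨ y = c)
    (hnadj : ¬ G.Adj a c) (hu : IsTight G S 0 u) (hua : G.Adj u a) (hub : G.Adj u b)
    (hw : IsTight G S 0 w) (hwb : G.Adj w b) (hwc : G.Adj w c) : False := by
  have huS : ∀ z ∈ S, G.Adj u z → z = a ∨ z = b := fun z hz h =>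
    hu.eq_or_eq hab ha hb (hu.mem_linkedPart hz h) hua hub h
  have hwS : ∀ z ∈ S, G.Adj w z → z = b ∨ z = c := fun z hz h =>
    hw.eq_or_eq hbc hb hc (hw.mem_linkedPart hz h) hwb hwc h
  have haS := (mem_linkedPart.1 ha).1
  have hbS := (mem_linkedPart.1 hb).1
  have hcS := (mem_linkedPart.1 hc).1
  have hcu : ¬ G.Adj c u := fun h => by
    rcases huS c hcS h.symm with h | h
    · exact hac h.symm
    · exact hbc h.symm
  have huw : u ≠ w := by rintro rfl; exact hcu hwc.symm
  -- After removing `a`, `b`, `c`, the vertices `a`, `u`, `w`, `c` are added in this order, each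
  -- with at most one neighbour already present. The new forest has one vertex more than `S`.
  set R : Finset V := ((S.erase a).erase b).erase c with hR
  have hRS : ∀ z ∈ R, z ∈ S ∧ z ≠ a ∧ z ≠ b ∧ z ≠ c := fun z hz => by
    simp only [hR, mem_erase] at hz
    exact ⟨hz.2.2.2, hz.2.2.1, hz.2.1, hz.1⟩
  have hRadj : ∀ x, (x = a ∨ x = b ∨ x = c) → ∀ z ∈ R, ¬ G.Adj x z := fun x hx z hz h => by
    have h1 := hRS z hz
    rcases hT x z hx h1.1 h with h2 | h2 | h2
    · exact h1.2.1 h2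
    · exact h1.2.2.1 h2
    · exact h1.2.2.2 h2
  have h0 : (edgesWithin G R).IsAcyclic :=
    edgesWithin_isAcyclic_mono (fun z hz => (hRS z hz).1) hS.1
  have h1 : (edgesWithin G (insert a R)).IsAcyclic :=
    edgesWithin_isAcyclic_insert_leaf h0 fun p hp _ _ hap _ =>
      (hRadj a (.inl rfl) p hp hap).elim
  have h2 : (edgesWithin G (insert u (insert a R))).IsAcyclic := by
    have key : ∀ p ∈ insert a R, G.Adj u p → p = a := fun p hp h => by
      rcases mem_insert.1 hp with rfl | hp
      · rfl
      · have := hRS p hp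
        exact (huS p this.1 h).resolve_right this.2.2.1
    exact edgesWithin_isAcyclic_insert_leaf h1 fun p hp q hq h h' =>
      (key p hp h).trans (key q hq h').symm
  have h3 : (edgesWithin G (insert w (insert u (insert a R)))).IsAcyclic := by
    have key : ∀ p ∈ insert u (insert a R), G.Adj w p → p = u := fun p hp h => by
      rcases mem_insert.1 hp with rfl | hp
      · rfl
      rcases mem_insert.1 hp with rfl | hp
      · rcases hwS p haS h with h | h
        · exact (hab h).elim
        · exact (hac h).elim
      · have h5 := hRS p hp
        rcases hwS p h5.1 h with h | h
        · exact (h5.2.2.1 h).elim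
        · exact (h5.2.2.2 h).elim
    exact edgesWithin_isAcyclic_insert_leaf h2 fun p hp q hq h h' =>
      (key p hp h).trans (key q hq h').symm
  have h4 : (edgesWithin G (insert c (insert w (insert u (insert a R))))).IsAcyclic := by
    have key : ∀ p ∈ insert w (insert u (insert a R)), G.Adj c p → p = w := fun p hp h => by
      rcases mem_insert.1 hp with rfl | hp
      · rfl
      rcases mem_insert.1 hp with rfl | hp
      · exact (hcu h).elim
      rcases mem_insert.1 hp with rfl | hp
      · exact (hnadj h.symm).elim
      · exact (hRadj c (.inr (.inr rfl)) p hp h).elim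
    exact edgesWithin_isAcyclic_insert_leaf h3 fun p hp q hq h h' =>
      (key p hp h).trans (key q hq h').symm
  have h5 := hS.2 _ h4
  have haR : a ∉ R := fun h => (hRS a h).2.1 rfl
  have hun : u ∉ insert a R := fun h => by
    rcases mem_insert.1 h with rfl | h
    · exact hu.1 haS
    · exact hu.1 (hRS u h).1
  have hwn : w ∉ insert u (insert a R) := fun h => by
    rcases mem_insert.1 h with rfl | h
    · exact huw rfl
    rcases mem_insert.1 h with rfl | h
    · exact hw.1 haS
    · exact hw.1 (hRS w h).1
  have hcn : c ∉ insert w (insert u (insert a R)) := fun h => by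
    rcases mem_insert.1 h with rfl | h
    · exact hw.1 hcS
    rcases mem_insert.1 h with rfl | h
    · exact hu.1 hcS
    rcases mem_insert.1 h with rfl | h
    · exact hac rfl
    · exact (hRS c h).2.2.2 rfl
  rw [card_insert_of_notMem hcn, card_insert_of_notMem hwn, card_insert_of_notMem hun,
    card_insert_of_notMem haR] at h5
  have e1 := card_erase_add_one haS
  have e2 := card_erase_add_one (mem_erase.2 ⟨hab.symm, hbS⟩)
  have e3 := card_erase_add_one (mem_erase.2 ⟨hbc.symm, mem_erase.2 ⟨hac.symm, hcS⟩⟩)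
  rw [← hR] at e3
  omega

variable {T : Finset V}

/-- In a component on three vertices, each carrying two tight vertices, any two of the vertices
have a common tight neighbour. -/
theorem IsMaxForestSet.exists_common_isTight (hS : IsMaxForestSet G S) {x y z : V}
    (hx : x ∈ linkedPart G S) (hy : y ∈ linkedPart G S)
    (hT : ∀ t ∈ linkedPart G S, (edgesWithin G S).Reachable x t → t = x ∨ t = y ∨ t = z)
    (hT' : ∀ t ∈ linkedPart G S, (edgesWithin G S).Reachable y t → t = x ∨ t = y ∨ t = z)
    (hcx : #(tightAt G S 0 x) = 2) (hcy : #(tightAt G S 0 y) = 2)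
    (hcz : #(tightAt G S 0 z) = 2) : ∃ w, IsTight G S 0 w ∧ G.Adj w x ∧ G.Adj w y := by
  by_contra! hcon
  -- Otherwise all tight neighbours of `x` and of `y` have their partner at `z`, giving `z` four of
  -- them.
  have hdisj : Disjoint (tightAt G S 0 x) (tightAt G S 0 y) := by
    rw [disjoint_left]
    intro w h1 h2
    rw [mem_tightAt] at h1 h2
    exact hcon w h1.2 h1.1.symm h2.1.symm
  have hsub : tightAt G S 0 x ∪ tightAt G S 0 y ⊆ tightAt G S 0 z := by
    intro w hw
    rcases mem_union.1 hw with h | h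
    · rw [mem_tightAt] at h ⊢
      obtain ⟨t, ht, htx, hwt, hr⟩ := hS.exists_partner h.2 hx h.1.symm
      rcases hT t ht hr with rfl | rfl | rfl
      · exact (htx rfl).elim
      · exact (hcon w h.2 h.1.symm hwt).elim
      · exact ⟨hwt.symm, h.2⟩
    · rw [mem_tightAt] at h ⊢
      obtain ⟨t, ht, hty, hwt, hr⟩ := hS.exists_partner h.2 hy h.1.symm
      rcases hT' t ht hr with rfl | rfl | rfl
      · exact (hcon w h.2 hwt h.1.symm).elim
      · exact (hty rfl).elim
      · exact ⟨hwt.symm, h.2⟩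
  have := card_le_card hsub
  rw [card_union_of_disjoint hdisj] at this
  omega

theorem IsMaxForestSet.false_of_card_eq_three (hS : IsMaxForestSet G S)
    (hTJ : T ⊆ linkedPart G S)
    (hT : ∀ x ∈ T, ∀ y, (edgesWithin G S).Reachable x y → y ∈ T)
    (hcard : #T = 3) (htwo : ∀ x ∈ T, #(tightAt G S 0 x) = 2) : False := by
  have hnonadj : ∃ a ∈ T, ∃ c ∈ T, a ≠ c ∧ ¬ G.Adj a c := by
    by_contra! hcon
    refine hS.1.cliqueFree le_rfl T ⟨fun a ha c hc hne => ?_, hcard⟩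
    exact ⟨(mem_linkedPart.1 (hTJ ha)).1, (mem_linkedPart.1 (hTJ hc)).1, hcon a ha c hc hne⟩
  obtain ⟨a, ha, c, hc, hac, hnadj⟩ := hnonadj
  obtain ⟨b, hb⟩ : ∃ b, (T.erase a).erase c = {b} := by
    rw [← card_eq_one, card_erase_of_mem (mem_erase.2 ⟨hac.symm, hc⟩), card_erase_of_mem ha, hcard]
  have hbT : b ∈ (T.erase a).erase c := by rw [hb]; exact mem_singleton_self b
  obtain ⟨hbc, hba, hbT⟩ := by simpa only [mem_erase] using hbT
  have hmem : ∀ t ∈ T, t = a ∨ t = b ∨ t = c := fun t ht => by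
    by_contra! h
    have : t ∈ (T.erase a).erase c := mem_erase.2 ⟨h.2.2, mem_erase.2 ⟨h.1, ht⟩⟩
    rw [hb, mem_singleton] at this
    exact h.2.1 this
  have hmem' : ∀ t ∈ T, t = b ∨ t = c ∨ t = a := fun t ht => by
    rcases hmem t ht with h | h | h <;> simp [h]
  obtain ⟨u, hu, hua, hub⟩ := hS.exists_common_isTight (hTJ ha) (hTJ hbT) (z := c)
    (fun t _ hr => hmem t (hT a ha t hr)) (fun t _ hr => hmem t (hT b hbT t hr))
    (htwo a ha) (htwo b hbT) (htwo c hc)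
  obtain ⟨w, hw, hwb, hwc⟩ := hS.exists_common_isTight (hTJ hbT) (hTJ hc) (z := a)
    (fun t _ hr => hmem' t (hT b hbT t hr)) (fun t _ hr => hmem' t (hT c hc t hr))
    (htwo b hbT) (htwo c hc) (htwo a ha)
  refine hS.false_of_isTight_pair (hTJ ha) (hTJ hbT) (hTJ hc) hba.symm hac hbc
    (fun x y hx hy h => ?_) hnadj hu hua hub hw hwb hwc
  have hxT : x ∈ T := by rcases hx with rfl | rfl | rfl <;> assumption
  have hr : (edgesWithin G S).Adj x y := ⟨(mem_linkedPart.1 (hTJ hxT)).1, hy, h⟩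
  exact hmem y (hT x hxT y hr.reachable)

/-- A 1-tight vertex meets two vertices of `T`, each then of load at most `3/2`, so the total is at
most `3/2 + 3/2 + 2`. Without one the loads are integers at most 2, and a total above 5 forces all
three to be 2. -/
theorem IsMaxForestSet.sum_load_le_five (hS : IsMaxForestSet G S) (hK : G.CliqueFree 4)
    (hε : 0 ≤ ε) (hΔ : ε * G.maxDegree ≤ 1 / 2) (hTJ : T ⊆ linkedPart G S)
    (hT : ∀ x ∈ T, ∀ y, (edgesWithin G S).Reachable x y → y ∈ T)
    (hcard : #T = 3) : ∑ x ∈ T, load G S ε x ≤ 5 := by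
  by_cases hone : ∃ x ∈ T, (tightAt G S 1 x).Nonempty
  · obtain ⟨x, hx, w, hw⟩ := hone
    obtain ⟨hxw, htw⟩ := mem_tightAt.1 hw
    obtain ⟨y, -, hyx, hwy, hr⟩ := hS.exists_partner htw (hTJ hx) hxw.symm
    have hy := hT x hx y hr
    have h1 := hS.load_le_of_nonempty hK hε hΔ (hTJ hx) ⟨w, hw⟩
    have h2 := hS.load_le_of_nonempty hK hε hΔ (hTJ hy) ⟨w, mem_tightAt.2 ⟨hwy.symm, htw⟩⟩
    have hyT : y ∈ T.erase x := mem_erase.2 ⟨hyx, hy⟩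
    have h3 : ∑ z ∈ (T.erase x).erase y, load G S ε z ≤ #((T.erase x).erase y) • (2 : ℝ) :=
      sum_le_card_nsmul _ _ _ fun z hz =>
        hS.load_le_two hK hε hΔ (hTJ (mem_of_mem_erase (mem_of_mem_erase hz)))
    have h4 : #((T.erase x).erase y) = 1 := by
      rw [card_erase_of_mem hyT, card_erase_of_mem hx, hcard]
    rw [h4, one_smul] at h3
    rw [← add_sum_erase T _ hx, ← add_sum_erase _ _ hyT]
    linarith
  · push Not at hone
    have hload : ∀ x ∈ T, load G S ε x = #(tightAt G S 0 x) := fun x hx => by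
      simp [load, hone x hx]
    rw [sum_congr rfl hload]
    by_contra! hcon
    have hcon : 5 < ∑ x ∈ T, #(tightAt G S 0 x) := by exact_mod_cast hcon
    have hle : ∀ x ∈ T, #(tightAt G S 0 x) ≤ 2 := fun x hx => hS.card_tightAt_zero_le hK (hTJ hx)
    refine hS.false_of_card_eq_three hTJ hT hcard fun x hx => ?_
    have h1 : ∑ z ∈ T.erase x, #(tightAt G S 0 z) ≤ #(T.erase x) • 2 :=
      sum_le_card_nsmul _ _ _ fun z hz => hle z (mem_of_mem_erase hz)
    rw [card_erase_of_mem hx, hcard] at h1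
    rw [← add_sum_erase T _ hx] at hcon
    have := hle x hx
    simp only [smul_eq_mul] at h1
    omega

/-- A component on `t` vertices has total load at most `3 t - 4`. -/
theorem IsMaxForestSet.sum_load_le (hS : IsMaxForestSet G S) (hK : G.CliqueFree 4)
    (hε : 0 ≤ ε) (hΔ : ε * G.maxDegree ≤ 1 / 2) (hTJ : T ⊆ linkedPart G S)
    (hT : ∀ x ∈ T, ∀ y, (edgesWithin G S).Reachable x y → y ∈ T) (hne : T.Nonempty) :
    ∑ x ∈ T, load G S ε x ≤ 3 * #T - 4 := by
  have htwo : 1 < #T := by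
    obtain ⟨x, hx⟩ := hne
    obtain ⟨hxS, y, hy, hxy⟩ := mem_linkedPart.1 (hTJ hx)
    have hr : (edgesWithin G S).Adj x y := ⟨hxS, hy, hxy⟩
    exact one_lt_card.2 ⟨x, hx, y, hT x hx y hr.reachable, hxy.ne⟩
  obtain h2 | h3 | h4 : #T = 2 ∨ #T = 3 ∨ 4 ≤ #T := by omega
  · obtain ⟨x, y, hxy, rfl⟩ := card_eq_two.1 h2
    have hx := hS.load_le_one hK hε hΔ (x := x) (y := y) (hTJ (by simp))
      fun z hr => by simpa using hT x (by simp) z hr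
    have hy := hS.load_le_one hK hε hΔ (x := y) (y := x) (hTJ (by simp))
      fun z hr => by simpa [or_comm] using hT y (by simp) z hr
    rw [sum_pair hxy, h2]
    norm_num
    linarith
  · have := hS.sum_load_le_five hK hε hΔ hTJ hT h3
    rw [h3]
    norm_num
    exact this
  · have h5 : ∑ x ∈ T, load G S ε x ≤ #T • (2 : ℝ) :=
      sum_le_card_nsmul _ _ _ fun x hx => hS.load_le_two hK hε hΔ (hTJ hx)
    have h6 : (4 : ℝ) ≤ #T := by exact_mod_cast h4
    rw [nsmul_eq_mul] at h5
    linarith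

theorem card_filter_adj_eq_degree [DecidableRel (edgesWithin G S).Adj] {x : V} (hx : x ∈ S) :
    (edgesWithin G S).degree x = #(S.filter (G.Adj x)) := by
  rw [← SimpleGraph.card_neighborFinset_eq_degree]
  congr 1
  ext y
  simp [edgesWithin_adj, hx]

theorem IsMaxForestSet.sum_load_linkedPart_le (hS : IsMaxForestSet G S) (hK : G.CliqueFree 4)
    (hε : 0 ≤ ε) (hΔ : ε * G.maxDegree ≤ 1 / 2) :
    ∑ x ∈ linkedPart G S, load G S ε x ≤
      ∑ x ∈ linkedPart G S, (2 * (#(S.filter (G.Adj x)) : ℝ) - 1) := by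
  classical
  let F := edgesWithin G S
  let J := linkedPart G S
  have hmaps : ∀ x ∈ J, F.connectedComponentMk x ∈ J.image F.connectedComponentMk :=
    fun x hx => mem_image_of_mem _ hx
  rw [← sum_fiberwise_of_maps_to hmaps, ← sum_fiberwise_of_maps_to hmaps]
  refine sum_le_sum fun C hC => ?_
  obtain ⟨x₀, hx₀, rfl⟩ := mem_image.1 hC
  set T := J.filter fun x => F.connectedComponentMk x = F.connectedComponentMk x₀ with hTdef
  have hTJ : T ⊆ J := filter_subset _ _
  have hT : ∀ x, x ∈ T ↔ F.connectedComponentMk x = F.connectedComponentMk x₀ := fun x => by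
    rw [hTdef, mem_filter, and_iff_right_iff_imp]
    intro h
    exact mem_linkedPart_of_reachable hx₀ (SimpleGraph.ConnectedComponent.exact h).symm
  have hclosed : ∀ x ∈ T, ∀ y, F.Reachable x y → y ∈ T := fun x hx y hr =>
    (hT y).2 ((SimpleGraph.ConnectedComponent.sound hr.symm).trans ((hT x).1 hx))
  have h1 := hS.sum_load_le hK hε hΔ hTJ hclosed ⟨x₀, (hT x₀).2 rfl⟩
  have h2 := two_mul_card_le_sum_degree F _ T hT
  have h3 : ∑ x ∈ T, F.degree x = ∑ x ∈ T, #(S.filter (G.Adj x)) :=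
    sum_congr rfl fun x hx => card_filter_adj_eq_degree (mem_linkedPart.1 (hTJ hx)).1
  rw [h3] at h2
  have h4 : 2 * (#T : ℝ) ≤ ∑ x ∈ T, (#(S.filter (G.Adj x)) : ℝ) + 2 := by exact_mod_cast h2
  rw [sum_sub_distrib, ← mul_sum, sum_const, nsmul_eq_mul, mul_one]
  linarith

end Component

/-! ### Double counting of the edges between `S` and its complement. -/

section Counting

set_option linter.unusedSectionVars false

variable {V : Type*} [Fintype V] [DecidableEq V] {G : SimpleGraph V} [DecidableRel G.Adj]
  {S : Finset V}

theorem sum_card_filter_adj_comm (A B : Finset V) :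
    ∑ w ∈ A, #(B.filter (G.Adj w)) = ∑ x ∈ B, #(A.filter (G.Adj x)) := by
  simp only [card_filter]
  rw [sum_comm]
  simp only [G.adj_comm]

theorem card_filter_adj_add_card_filter_compl (x : V) :
    #(S.filter (G.Adj x)) + #(Sᶜ.filter (G.Adj x)) = G.degree x := by
  rw [← card_union_of_disjoint (disjoint_filter_filter disjoint_compl_right), ← filter_union,
    union_compl, ← SimpleGraph.card_neighborFinset_eq_degree]
  congr 1
  ext y
  simp

theorem card_linkedPart_add_card_isolatedPart : #(linkedPart G S) + #(isolatedPart G S) = #S :=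
  card_filter_add_card_filter_not _

/-- The factor 2 is the number of linked neighbours of a tight vertex. -/
theorem sum_load_eq (ε : ℝ) :
    ∑ x ∈ linkedPart G S, load G S ε x =
      ∑ w ∈ Sᶜ, 2 * ((if IsTight G S 0 w then 1 else 0) + ε * if IsTight G S 1 w then 1 else 0) := by
  have key : ∀ k, ∑ x ∈ linkedPart G S, #(tightAt G S k x) =
      ∑ w ∈ Sᶜ, 2 * if IsTight G S k w then 1 else 0 := by
    intro k
    have h1 : ∀ x, tightAt G S k x = (Sᶜ.filter (IsTight G S k)).filter (G.Adj x) := by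
      intro x
      ext w
      simp only [mem_tightAt, mem_filter, mem_compl]
      exact ⟨fun h => ⟨⟨h.2.1, h.2⟩, h.1⟩, fun h => ⟨h.2, h.1.2⟩⟩
    simp only [h1]
    rw [← sum_card_filter_adj_comm, sum_filter]
    refine sum_congr rfl fun w _ => ?_
    split_ifs with h
    · exact h.2.1
    · rfl
  have h0 := congrArg (Nat.cast (R := ℝ)) (key 0)
  have h1 := congrArg (Nat.cast (R := ℝ)) (key 1)
  push_cast at h0 h1
  simp only [load, sum_add_distrib, ← mul_sum, mul_add] at h0 h1 ⊢
  rw [h0, h1]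
  ring

theorem IsMaxForestSet.three_mul_card_compl_le (hS : IsMaxForestSet G S) (hK : G.CliqueFree 4)
    (hpos : 0 < G.maxDegree) :
    3 * (#Sᶜ : ℝ) ≤ #S * (G.maxDegree - 1 / 2) := by
  have hD : (1 : ℝ) ≤ G.maxDegree := by exact_mod_cast hpos
  -- This `ε` makes the contribution `(1 - ε) Δ` of an isolated vertex equal to `Δ - 1/2`, the
  -- average bound for linked ones.
  obtain ⟨ε, hε0, hε1, hεΔ⟩ : ∃ ε : ℝ, 0 ≤ ε ∧ ε ≤ 1 / 2 ∧ ε * G.maxDegree = 1 / 2 := by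
    refine ⟨1 / (2 * G.maxDegree), by positivity, ?_, by field_simp⟩
    rw [div_le_div_iff₀ (by positivity) (by norm_num)]
    linarith
  set J := linkedPart G S with hJ
  set I := isolatedPart G S with hI
  let wt : V → ℝ := fun w =>
    (if IsTight G S 0 w then 1 else 0) + ε * if IsTight G S 1 w then 1 else 0
  have hw : ∀ w ∈ Sᶜ, (3 : ℝ) ≤
      wt w + (#(J.filter (G.Adj w)) : ℝ) + (1 - ε) * #(I.filter (G.Adj w)) := by
    intro w hwS
    have hwS := mem_compl.1 hwS
    have h2 := hS.two_le_card_linked hwS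
    rw [← hJ] at h2
    have hwt : 0 ≤ wt w := by positivity
    have hi0 : (0 : ℝ) ≤ #(I.filter (G.Adj w)) := by positivity
    by_cases h3 : 3 ≤ #(J.filter (G.Adj w))
    · have h3 : (3 : ℝ) ≤ #(J.filter (G.Adj w)) := by exact_mod_cast h3
      nlinarith
    have h2 : #(J.filter (G.Adj w)) = 2 := by omega
    obtain h | h | h : #(I.filter (G.Adj w)) = 0 ∨ #(I.filter (G.Adj w)) = 1 ∨
        2 ≤ #(I.filter (G.Adj w)) := by omega
    · have ht : IsTight G S 0 w := ⟨hwS, h2, h⟩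
      have ht1 : ¬ IsTight G S 1 w := fun h' => ht.ne zero_ne_one h' rfl
      simp only [wt, ht, ht1, h2, h, if_true, if_false]
      norm_num
    · have ht : IsTight G S 1 w := ⟨hwS, h2, h⟩
      have ht1 : ¬ IsTight G S 0 w := fun h' => ht.ne one_ne_zero h' rfl
      simp only [wt, ht, ht1, h2, h, if_true, if_false]
      norm_num
      linarith
    -- Two isolated neighbours contribute at least `2 (1 - ε) ≥ 1`, so no extra weight is needed.
    · have h : (2 : ℝ) ≤ #(I.filter (G.Adj w)) := by exact_mod_cast h
      rw [h2]
      push_cast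
      nlinarith
  have hsum := sum_le_sum hw
  rw [sum_const, nsmul_eq_mul, sum_add_distrib, sum_add_distrib, ← mul_sum] at hsum
  have hload := hS.sum_load_linkedPart_le hK hε0 hεΔ.le
  rw [sum_load_eq, ← mul_sum] at hload
  have hswap : ∀ B : Finset V, ∑ w ∈ Sᶜ, (#(B.filter (G.Adj w)) : ℝ) =
      ∑ x ∈ B, (#(Sᶜ.filter (G.Adj x)) : ℝ) := fun B => by
    exact_mod_cast sum_card_filter_adj_comm Sᶜ B
  rw [hswap, hswap] at hsum
  have hdeg : ∀ x, (#(Sᶜ.filter (G.Adj x)) : ℝ) ≤ G.maxDegree - #(S.filter (G.Adj x)) := by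
    intro x
    have h1 := card_filter_adj_add_card_filter_compl (G := G) (S := S) x
    have h2 := G.degree_le_maxDegree x
    have h3 : (#(S.filter (G.Adj x)) : ℝ) + #(Sᶜ.filter (G.Adj x)) ≤ G.maxDegree := by
      exact_mod_cast h1.trans_le h2
    linarith
  have hJsum : ∑ x ∈ J, (#(Sᶜ.filter (G.Adj x)) : ℝ) ≤
      #J * G.maxDegree - ∑ x ∈ J, (#(S.filter (G.Adj x)) : ℝ) := by
    refine (sum_le_sum fun x _ => hdeg x).trans_eq ?_
    rw [sum_sub_distrib, sum_const, nsmul_eq_mul]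
  have hIsum : ∑ x ∈ I, (#(Sᶜ.filter (G.Adj x)) : ℝ) ≤ #I * G.maxDegree := by
    rw [← nsmul_eq_mul]
    refine sum_le_card_nsmul _ _ _ fun x _ => (hdeg x).trans ?_
    have : (0 : ℝ) ≤ #(S.filter (G.Adj x)) := by positivity
    linarith
  have hIsum' := mul_le_mul_of_nonneg_left hIsum (by linarith : 0 ≤ 1 - ε)
  have hcard : (#J : ℝ) + #I = #S := by exact_mod_cast card_linkedPart_add_card_isolatedPart
  rw [sum_sub_distrib, ← mul_sum, sum_const, nsmul_eq_mul, mul_one, ← hJ] at hload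
  have hexp : (1 - ε) * (#I * (G.maxDegree : ℝ)) = #I * G.maxDegree - #I * (1 / 2) := by
    rw [← hεΔ]; ring
  have hgoal : (#S : ℝ) * (G.maxDegree - 1 / 2) =
      #J * G.maxDegree + #I * G.maxDegree - #J * (1 / 2) - #I * (1 / 2) := by
    rw [← hcard]; ring
  rw [hgoal]
  linarith

end Counting

theorem theorem3p1 {V : Type*} [Fintype V] (G : SimpleGraph V) [DecidableRel G.Adj]
    (hK4 : G.CliqueFree 4) (hΔ : 0 < G.maxDegree) :
    6 * (Fintype.card V : ℝ) / (2 * (G.maxDegree : ℝ) + 5) ≤ (acyclicNumber G : ℝ) := by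
  classical
  obtain ⟨S, hSmem, hSmax⟩ := exists_max_image
    (univ.filter fun T : Finset V => (edgesWithin G T).IsAcyclic) card
    ⟨∅, mem_filter.2 ⟨mem_univ _, SimpleGraph.isAcyclic_bot.anti fun _ _ h =>
      (notMem_empty _ h.1).elim⟩⟩
  have hS : IsMaxForestSet G S :=
    ⟨(mem_filter.1 hSmem).2, fun T hT => hSmax T (mem_filter.2 ⟨mem_univ _, hT⟩)⟩
  have hle : #S ≤ acyclicNumber G :=
    le_sup (f := card) (mem_filter.2 ⟨mem_univ S, IsAcyclicSet.of_edgesWithin hS.1⟩)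
  have hle : (#S : ℝ) ≤ acyclicNumber G := by exact_mod_cast hle
  have h1 := hS.three_mul_card_compl_le hK4 hΔ
  have h2 : (#S : ℝ) + #Sᶜ = Fintype.card V := by exact_mod_cast card_add_card_compl S
  refine le_trans ?_ hle
  rw [div_le_iff₀ (by positivity)]
  linarith
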